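/- Let $m\ge 1$. A function $g:\mathbb R\to\mathbb R$ is called a tropical entire function of order at most $1$ here if it is continuous and piecewise linear, its breakpoints have no finite accumulation point, and it has no poles, i.e. $\omega_g(x):=g'(x^+)-g'(x^-)\ge 0$ for all $x\in\mathbb R$; constants are allowed. A root of $g$ is a point $x$ with $\omega_g(x)>0$, and $\omega_g(x)$ is its multiplicity. The integrated counting function of the roots of $g$ is $$N\Bigl(r,\frac{1_0}{g}\oslash\Bigr)=\frac12\sum_{|x|<r,\ \omega_g(x)>0}\omega_g(x)\,(r-|x|),\qquad r>0.$$ Let $f=[f_0:\dots:f_m]:\mathbb R\to\mathbb{TP}^m$ be a $1$-st tropical holomorphic curve with reduced representation $(f_0,\dots,f_m)$: every $f_i$ is tropical entire of order at most $1$, not all $f_i$ are constant, and no root is common to all the $f_i$. Put $$T_f(r)=\tfrac12\bigl(M(r)+M(-r)\bigr)-M(0),\qquad M(x)=\max_{0\le i\le m}f_i(x),$$ and let $$C_0(f_0,\dots,f_m)(x)=\max_{\pi}\sum_{i=0}^m f_i\bigl(x+\pi(i)\bigr),$$ the maximum being over all permutations $\pi$ of $\{0,\dots,m\}$, be the tropical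 Casoratian. Suppose that $$\rho_2:=\limsup_{r\to+\infty}\frac{\log\log T_f(r)}{\log r}<1$$ (if $T_f\equiv 0$, read $\rho_2=0$), and let $\sigma\in(0,1-\rho_2)$. Then there is a measurable set $E\subset\mathbb R$ of finite logarithmic measure, $\int_{E\cap[1,\infty)}\frac{dr}{r}<\infty$, such that $$\sum_{i=0}^m N\Bigl(r,\frac{1_0}{f_i}\oslash\Bigr)=N\Bigl(r,\frac{1_0}{C_0(f_0,\dots,f_m)}\oslash\Bigr)+o\Bigl(\frac{T_f(r)}{r^{\sigma}}\Bigr)\qquad (r\to\infty,\ r\notin E).$$ -/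

import Mathlib

open Filter Topology Asymptotics MeasureTheory

noncomputable section

namespace TropNev

/-- `g : ℝ → ℝ` is an `n`-th tropical meromorphic function: there are breakpoints
`⋯ < x₋₁ < x₀ < x₁ < ⋯` without finite accumulation point such that on every `[xᵢ, xᵢ₊₁]` the
function `g` is a polynomial, and the supremum of the degrees of these polynomials is `n`.
Continuity is automatic since the pieces are closed intervals. For `n = 0` these are the constant
functions, for `n = 1` the non-constant continuous piecewise linear functions. -/
def IsMeromorphic (n : ℕ) (g : ℝ → ℝ) : Prop :=
  ∃ (x : ℤ → ℝ) (p : ℤ → Polynomial ℝ),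
    StrictMono x ∧ Tendsto x atTop atTop ∧ Tendsto x atBot atBot ∧
    (∀ i, (p i).natDegree ≤ n) ∧ (∃ i, (p i).natDegree = n) ∧
    ∀ i, ∀ t ∈ Set.Icc (x i) (x (i + 1)), g t = (p i).eval t

/-- The one-sided value `g⁽ʲ⁾(x⁺)`, the limit of the `j`-th derivative from the right. -/
def rightDeriv (j : ℕ) (g : ℝ → ℝ) (x : ℝ) : ℝ := limUnder (𝓝[>] x) (iteratedDeriv j g)

/-- The one-sided value `g⁽ʲ⁾(x⁻)`, the limit of the `j`-th derivative from the left. -/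
def leftDeriv (j : ℕ) (g : ℝ → ℝ) (x : ℝ) : ℝ := limUnder (𝓝[<] x) (iteratedDeriv j g)

/-- `sgn(x⁺)`, with `sgn(0⁺) = 1`. -/
def sgnRight (x : ℝ) : ℝ := if 0 ≤ x then 1 else -1

/-- `sgn(x⁻)`, with `sgn(0⁻) = -1`. -/
def sgnLeft (x : ℝ) : ℝ := if 0 < x then 1 else -1

/-- `ω_g⁽ʲ⁾(x) = (sgnʲ⁺¹(x⁺) g⁽ʲ⁾(x⁺) - sgnʲ⁺¹(x⁻) g⁽ʲ⁾(x⁻)) / j!`. The point `x` is a `j`-th root of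
`g` if this is positive, a `j`-th pole if it is negative, with multiplicity the absolute value.
For `j = 1` it is the jump of the slope of `g` at `x`. -/
def omega (j : ℕ) (g : ℝ → ℝ) (x : ℝ) : ℝ :=
  (sgnRight x ^ (j + 1) * rightDeriv j g x - sgnLeft x ^ (j + 1) * leftDeriv j g x) / j.factorial

/-- `n`-th tropical entire functions: `n`-th tropical meromorphic functions without poles. -/
def IsEntire (n : ℕ) (g : ℝ → ℝ) : Prop :=
  IsMeromorphic n g ∧ ∀ j ∈ Finset.Icc 1 n, ∀ x : ℝ, ¬ omega j g x < 0

/-- The `j`-th integrated max-plus counting function of the poles of `g`,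
`N⁽ʲ⁾(r, g) = (1/2) ∑ |ω_g⁽ʲ⁾(z)| (r - |z|)ʲ`, summed over the `j`-th poles `z ∈ (-r, r)` of `g`
(finitely many if `g` is tropical meromorphic). -/
def countingN (j : ℕ) (r : ℝ) (g : ℝ → ℝ) : ℝ :=
  (1 / 2) * ∑ᶠ z ∈ {z : ℝ | z ∈ Set.Ioo (-r) r ∧ omega j g z < 0}, |omega j g z| * (r - |z|) ^ j

/-- The tropical reciprocal `1₀ ⊘ g`; the tropical unit `1₀` is the real number `0` and the tropical
quotient is the ordinary difference. -/
def tropInv (g : ℝ → ℝ) : ℝ → ℝ := fun x => 0 - g x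

/-- The points of `ℝ_max^{m+1}` other than the tropical zero vector, where `ℝ_max = ℝ ∪ {-∞}`. -/
abbrev NonzeroVec (m : ℕ) : Type := {a : Fin (m + 1) → WithBot ℝ // a ≠ fun _ => ⊥}

/-- Two vectors are equivalent if they differ by tropical multiplication by a real scalar. -/
instance projSetoid (m : ℕ) : Setoid (NonzeroVec m) where
  r a b := ∃ c : ℝ, ∀ i, a.1 i = (c : WithBot ℝ) + b.1 i
  iseqv :=
    { refl := fun a => ⟨0, fun i => by simp⟩
      symm := by
        rintro a b ⟨c, h⟩
        refine ⟨-c, fun i => ?_⟩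
        rw [h i, ← add_assoc, ← WithBot.coe_add]
        simp
      trans := by
        rintro a b d ⟨c, h⟩ ⟨c', h'⟩
        refine ⟨c + c', fun i => ?_⟩
        rw [h i, h' i, WithBot.coe_add, add_assoc] }

/-- The tropical projective space `𝕋ℙᵐ`. -/
abbrev TropProj (m : ℕ) : Type := Quotient (projSetoid m)

/-- The point `[a₀ : ⋯ : a_m]` with real homogeneous coordinates. -/
def projPoint {m : ℕ} (a : Fin (m + 1) → ℝ) : TropProj m :=
  Quotient.mk (projSetoid m)
    ⟨fun i => (a i : WithBot ℝ), fun h => WithBot.coe_ne_bot (congrFun h 0)⟩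

/-- `f : ℝ → 𝕋ℙᵐ` is an `n`-th tropical holomorphic curve with reduced representation
`(F₀, …, F_m)`: each `Fᵢ` is `dᵢ`-th tropical entire, `max dᵢ = n`, `f = [F₀ : ⋯ : F_m]`, and no
`j`-th root is common to all the `Fᵢ`. -/
structure IsReducedRep (n : ℕ) {m : ℕ} (f : ℝ → TropProj m) (F : Fin (m + 1) → ℝ → ℝ) : Prop where
  entire : ∃ d : Fin (m + 1) → ℕ, (∀ i, IsEntire (d i) (F i)) ∧ Finset.univ.sup d = n
  represents : ∀ x, f x = projPoint (fun i => F i x)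
  reduced : ∀ j ∈ Finset.Icc 1 n, ∀ x : ℝ, ¬ ∀ i, 0 < omega j (F i) x

/-- The tropical Cartan characteristic function
`T_f(r) = (M(r) + M(-r)) / 2 - M(0)`, `M(x) = maxᵢ Fᵢ(x)`, where `(F₀, …, F_m)` is a reduced
representation of `f`. -/
def cartanT {m : ℕ} (F : Fin (m + 1) → ℝ → ℝ) (r : ℝ) : ℝ :=
  let M : ℝ → ℝ := fun x => Finset.univ.sup' Finset.univ_nonempty (fun i => F i x)
  (1 / 2) * (M r + M (-r)) - M 0

/-- The tropical Casoratian
`C₀(F₀, …, F_m)(x) = max_π ∑ᵢ Fᵢ(x + π(i))`, over all permutations `π` of `{0, …, m}`: the tropical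
determinant of the matrix of the shifts `Fᵢ(x + k)`, `0 ≤ k ≤ m`. -/
def casoratian {m : ℕ} (F : Fin (m + 1) → ℝ → ℝ) (x : ℝ) : ℝ :=
  Finset.univ.sup' Finset.univ_nonempty
    (fun π : Equiv.Perm (Fin (m + 1)) => ∑ i, F i (x + ((π i : ℕ) : ℝ)))

/-- The hyper-order `limsup_{r → ∞} log log T(r) / log r`, an extended real number. -/
def hyperOrder (T : ℝ → ℝ) : EReal :=
  limsup (fun r : ℝ => ((Real.log (Real.log (T r)) / Real.log r : ℝ) : EReal)) atTop

/-- `E` has finite logarithmic measure: `∫_{E ∩ [1, ∞)} dr / r < ∞`. -/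
def FiniteLogMeasure (E : Set ℝ) : Prop :=
  MeasurableSet E ∧ ∫⁻ r in E ∩ Set.Ici 1, ENNReal.ofReal (1 / r) < ⊤

end TropNev

end

/-!
The components `Fᵢ` of a reduced representation are convex and locally piecewise linear, and so is
the Casoratian `C₀`, as a maximum of sums of shifts. The tropical Jensen formula
(`countingN_tropInv`) says that the integrated counting function of the roots of such a function `g`
is `jensen g r = (g r + g (-r)) / 2 - g 0`; it follows from writing `g` on a bounded interval as an
affine function plus ramps at its breakpoints. So everything reduces to comparing `C₀` with `∑ Fᵢ`
at the three points `±r` and `0`, where the two functions differ by sums of increments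
`Fᵢ(x + k) - Fᵢ(x)`, `0 ≤ k ≤ m`.

By convexity (`abs_increment_le`) an increment at `±r` is at most `k` times a constant plus the slope
of a chord from `±r` to `±R`. With `R = r + r ^ s` and since the characteristic function `T`
dominates all the components (`exists_abs_le_mul_cartanT`), it is `O(1 + T(R) / r ^ s)`. Choose `s`
strictly between `σ` and `1` minus the hyper-order. A growth lemma of Borel type
(`finiteLogMeasure_increment`), applied to `log T`, gives `T(R) ≤ 2 T(r)` outside a set of finite
logarithmic measure, and `O(1 + T(r) / r ^ s)` is `o(T(r) / r ^ σ)` provided that `T` grows at least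
linearly.

As `T` is itself of the form `jensen M` with `M` convex, it either grows at least linearly or
vanishes identically. In the latter case all the components are affine (`affine_of_le`), and so is
the Casoratian, so that both counting functions are zero.
-/

noncomputable section

namespace TropNev

/-! ### Locally piecewise linear functions -/

/-- Near `x` the graph of `g` consists of two segments meeting over `x`, of slope `a` on the left
and slope `b` on the right. Asking this at every point is the local form of being continuous and
piecewise linear with a discrete set of breakpoints; unlike an enumeration of the breakpoints it is
visibly stable under sums, shifts and maxima. -/
def HasSlopes (g : ℝ → ℝ) (x a b : ℝ) : Prop :=
  (∀ᶠ y in 𝓝[<] x, g y = g x + a * (y - x)) ∧ ∀ᶠ y in 𝓝[>] x, g y = g x + b * (y - x)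

/-- `g` is piecewise linear near every point. -/
def IsPiecewiseLinear (g : ℝ → ℝ) : Prop := ∀ x, ∃ a b, HasSlopes g x a b

lemma rightDeriv_one_eq {g : ℝ → ℝ} {x b : ℝ} (h : ∀ᶠ y in 𝓝[>] x, g y = g x + b * (y - x)) :
    rightDeriv 1 g x = b := by
  refine Tendsto.limUnder_eq (tendsto_const_nhds.congr' ?_)
  filter_upwards [eventually_eventually_nhdsWithin.2 h, self_mem_nhdsWithin] with y hy hxy
  rw [isOpen_Ioi.nhdsWithin_eq hxy] at hy
  have hd : HasDerivAt (fun y => g x + b * (y - x)) b y := by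
    simpa using (((hasDerivAt_id y).sub_const x).const_mul b).const_add (g x)
  rw [iteratedDeriv_one]
  exact ((hd.congr_of_eventuallyEq hy).deriv).symm

lemma leftDeriv_one_eq {g : ℝ → ℝ} {x a : ℝ} (h : ∀ᶠ y in 𝓝[<] x, g y = g x + a * (y - x)) :
    leftDeriv 1 g x = a := by
  refine Tendsto.limUnder_eq (tendsto_const_nhds.congr' ?_)
  filter_upwards [eventually_eventually_nhdsWithin.2 h, self_mem_nhdsWithin] with y hy hxy
  rw [isOpen_Iio.nhdsWithin_eq hxy] at hy
  have hd : HasDerivAt (fun y => g x + a * (y - x)) a y := by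
    simpa using (((hasDerivAt_id y).sub_const x).const_mul a).const_add (g x)
  rw [iteratedDeriv_one]
  exact ((hd.congr_of_eventuallyEq hy).deriv).symm

namespace HasSlopes

variable {g h : ℝ → ℝ} {x a b a' b' : ℝ}

lemma omega_one (hg : HasSlopes g x a b) : omega 1 g x = b - a := by
  have h1 : sgnRight x ^ 2 = 1 := by unfold sgnRight; split_ifs <;> norm_num
  have h2 : sgnLeft x ^ 2 = 1 := by unfold sgnLeft; split_ifs <;> norm_num
  simp [omega, h1, h2, rightDeriv_one_eq hg.2, leftDeriv_one_eq hg.1]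

lemma add (hg : HasSlopes g x a b) (hh : HasSlopes h x a' b') :
    HasSlopes (fun y => g y + h y) x (a + a') (b + b') := by
  constructor
  · filter_upwards [hg.1, hh.1] with y h1 h2
    rw [h1, h2]; ring
  · filter_upwards [hg.2, hh.2] with y h1 h2
    rw [h1, h2]; ring

lemma const_mul (c : ℝ) (hg : HasSlopes g x a b) :
    HasSlopes (fun y => c * g y) x (c * a) (c * b) := by
  constructor
  · filter_upwards [hg.1] with y h1
    rw [h1]; ring
  · filter_upwards [hg.2] with y h1
    rw [h1]; ring

lemma tropInv (hg : HasSlopes g x a b) : HasSlopes (tropInv g) x (-a) (-b) := by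
  constructor
  · filter_upwards [hg.1] with y h1
    simp only [TropNev.tropInv, h1]; ring
  · filter_upwards [hg.2] with y h1
    simp only [TropNev.tropInv, h1]; ring

lemma sum {ι : Type*} (s : Finset ι) {G : ι → ℝ → ℝ} {A B : ι → ℝ}
    (hG : ∀ i ∈ s, HasSlopes (G i) x (A i) (B i)) :
    HasSlopes (fun y => ∑ i ∈ s, G i y) x (∑ i ∈ s, A i) (∑ i ∈ s, B i) := by
  constructor
  · filter_upwards [(Finset.eventually_all s).2 fun i hi => (hG i hi).1] with y h1
    rw [Finset.sum_congr rfl h1, Finset.sum_add_distrib, Finset.sum_mul]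
  · filter_upwards [(Finset.eventually_all s).2 fun i hi => (hG i hi).2] with y h1
    rw [Finset.sum_congr rfl h1, Finset.sum_add_distrib, Finset.sum_mul]

lemma comp_add_const (c : ℝ) (hg : HasSlopes g (x + c) a b) :
    HasSlopes (fun y => g (y + c)) x a b := by
  have hl : Tendsto (fun y : ℝ => y + c) (𝓝[<] x) (𝓝[<] (x + c)) :=
    tendsto_nhdsWithin_of_tendsto_nhds_of_eventually_within _
      ((continuous_add_const c).continuousAt.tendsto.mono_left nhdsWithin_le_nhds)
      (by filter_upwards [self_mem_nhdsWithin] with y hy; simpa using hy)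
  have hr : Tendsto (fun y : ℝ => y + c) (𝓝[>] x) (𝓝[>] (x + c)) :=
    tendsto_nhdsWithin_of_tendsto_nhds_of_eventually_within _
      ((continuous_add_const c).continuousAt.tendsto.mono_left nhdsWithin_le_nhds)
      (by filter_upwards [self_mem_nhdsWithin] with y hy; simpa using hy)
  constructor
  · filter_upwards [hl.eventually hg.1] with y hy
    rw [hy]; ring
  · filter_upwards [hr.eventually hg.2] with y hy
    rw [hy]; ring

/-- Two segments issuing from points over `x` are ordered near `x`: by their values over `x` if
these differ, and otherwise by their slopes. -/
lemma sup (hg : HasSlopes g x a b) (hh : HasSlopes h x a' b') :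
    ∃ c d, HasSlopes (fun y => g y ⊔ h y) x c d := by
  have key : ∀ u v p q : ℝ, u < v → ∀ᶠ y in 𝓝 x, u + p * (y - x) < v + q * (y - x) := by
    intro u v p q huv
    have c1 : ContinuousAt (fun y : ℝ => u + p * (y - x)) x := by fun_prop
    have c2 : ContinuousAt (fun y : ℝ => v + q * (y - x)) x := by fun_prop
    exact c1.eventually_lt c2 (by simpa using huv)
  rcases lt_trichotomy (g x) (h x) with hlt | heq | hgt
  · refine ⟨a', b', ?_, ?_⟩
    · filter_upwards [hg.1, hh.1, nhdsWithin_le_nhds (key _ _ a a' hlt)] with y h1 h2 h3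
      rw [sup_eq_right.2 hlt.le, sup_eq_right.2 (by rw [h1, h2]; exact h3.le), h2]
    · filter_upwards [hg.2, hh.2, nhdsWithin_le_nhds (key _ _ b b' hlt)] with y h1 h2 h3
      rw [sup_eq_right.2 hlt.le, sup_eq_right.2 (by rw [h1, h2]; exact h3.le), h2]
  · refine ⟨a ⊓ a', b ⊔ b', ?_, ?_⟩
    · filter_upwards [hg.1, hh.1, self_mem_nhdsWithin] with y h1 h2 (h3 : y < x)
      rw [h1, h2, ← heq, sup_idem, max_add_add_left]
      rcases le_total a a' with h | h
      · rw [inf_eq_left.2 h, max_eq_left (mul_le_mul_of_nonpos_right h (by linarith))]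
      · rw [inf_eq_right.2 h, max_eq_right (mul_le_mul_of_nonpos_right h (by linarith))]
    · filter_upwards [hg.2, hh.2, self_mem_nhdsWithin] with y h1 h2 (h3 : x < y)
      rw [h1, h2, ← heq, sup_idem, max_add_add_left, max_mul_of_nonneg _ _ (by linarith)]
  · refine ⟨a, b, ?_, ?_⟩
    · filter_upwards [hg.1, hh.1, nhdsWithin_le_nhds (key _ _ a' a hgt)] with y h1 h2 h3
      rw [sup_eq_left.2 hgt.le, sup_eq_left.2 (by rw [h1, h2]; exact h3.le), h1]
    · filter_upwards [hg.2, hh.2, nhdsWithin_le_nhds (key _ _ b' b hgt)] with y h1 h2 h3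
      rw [sup_eq_left.2 hgt.le, sup_eq_left.2 (by rw [h1, h2]; exact h3.le), h1]

/-- A point where the two slopes agree is an interior point of an affine piece. -/
lemma eventually_nhds (hg : HasSlopes g x a a) : ∀ᶠ y in 𝓝 x, g y = g x + a * (y - x) := by
  rw [← nhdsNE_sup_pure, ← nhdsLT_sup_nhdsGT, eventually_sup, eventually_sup]
  exact ⟨⟨hg.1, hg.2⟩, by simp⟩

lemma le_of_convexOn (hg : HasSlopes g x a b) (hc : ConvexOn ℝ Set.univ g) : a ≤ b := by
  have e1 := hg.1
  have e2 := hg.2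
  rw [eventually_iff, mem_nhdsLT_iff_exists_Ioo_subset] at e1
  rw [eventually_iff, mem_nhdsGT_iff_exists_Ioo_subset] at e2
  obtain ⟨l, hl, hl'⟩ := e1
  obtain ⟨u, hu, hu'⟩ := e2
  simp only [Set.mem_Iio, Set.mem_Ioi] at hl hu
  obtain ⟨ε, hε, hε'⟩ := exists_between (lt_min (sub_pos.2 hl) (sub_pos.2 hu))
  rw [lt_min_iff] at hε'
  have h1 : g (x - ε) = g x + a * (x - ε - x) := hl' ⟨by linarith, by linarith⟩
  have h2 : g (x + ε) = g x + b * (x + ε - x) := hu' ⟨by linarith, by linarith⟩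
  have h3 := hc.2 (Set.mem_univ (x - ε)) (Set.mem_univ (x + ε)) (by norm_num : (0 : ℝ) ≤ 1 / 2)
    (by norm_num : (0 : ℝ) ≤ 1 / 2) (by norm_num)
  simp only [smul_eq_mul] at h3
  rw [show 1 / 2 * (x - ε) + 1 / 2 * (x + ε) = x by ring, h1, h2] at h3
  have : a * ε ≤ b * ε := by nlinarith
  exact le_of_mul_le_mul_right this hε

end HasSlopes

lemma hasSlopes_ramp (z x : ℝ) :
    HasSlopes (fun y => max (y - z) 0) x (if z < x then 1 else 0) (if z ≤ x then 1 else 0) := by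
  constructor
  · split_ifs with h
    · filter_upwards [nhdsWithin_le_nhds (Ioi_mem_nhds h)] with y (hy : z < y)
      rw [max_eq_left (by linarith), max_eq_left (by linarith)]; ring
    · filter_upwards [self_mem_nhdsWithin] with y (hy : y < x)
      rw [max_eq_right (by linarith), max_eq_right (by linarith)]; ring
  · split_ifs with h
    · filter_upwards [self_mem_nhdsWithin] with y (hy : x < y)
      rw [max_eq_left (by linarith), max_eq_left (by linarith)]; ring
    · filter_upwards [nhdsWithin_le_nhds (Iio_mem_nhds (not_le.1 h))] with y (hy : y < z)
      rw [max_eq_right (by linarith), max_eq_right (by linarith)]; ring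

lemma IsPiecewiseLinear.eventually_hasSlopes {g : ℝ → ℝ} (hg : IsPiecewiseLinear g) (x : ℝ) :
    ∀ᶠ y in 𝓝[≠] x, ∃ a, HasSlopes g y a a := by
  obtain ⟨a, b, h1, h2⟩ := hg x
  rw [← nhdsLT_sup_nhdsGT, eventually_sup]
  constructor
  · filter_upwards [eventually_eventually_nhdsWithin.2 h1, h1, self_mem_nhdsWithin]
      with y hy hy' hxy
    rw [isOpen_Iio.nhdsWithin_eq hxy] at hy
    have : ∀ᶠ t in 𝓝 y, g t = g y + a * (t - y) := by
      filter_upwards [hy] with t ht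
      rw [ht, hy']; ring
    exact ⟨a, nhdsWithin_le_nhds this, nhdsWithin_le_nhds this⟩
  · filter_upwards [eventually_eventually_nhdsWithin.2 h2, h2, self_mem_nhdsWithin]
      with y hy hy' hxy
    rw [isOpen_Ioi.nhdsWithin_eq hxy] at hy
    have : ∀ᶠ t in 𝓝 y, g t = g y + b * (t - y) := by
      filter_upwards [hy] with t ht
      rw [ht, hy']; ring
    exact ⟨b, nhdsWithin_le_nhds this, nhdsWithin_le_nhds this⟩

lemma IsPiecewiseLinear.finite_breakpoints {g : ℝ → ℝ} (hg : IsPiecewiseLinear g) (R : ℝ) :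
    {x ∈ Set.Icc (-R) R | omega 1 g x ≠ 0}.Finite := by
  by_contra hinf
  obtain ⟨x, -, hx⟩ := Set.Infinite.exists_accPt_of_subset_isCompact hinf isCompact_Icc
    (Set.sep_subset _ _)
  rw [accPt_iff_frequently_nhdsNE] at hx
  obtain ⟨y, hy, a, ha⟩ := (hx.and_eventually (hg.eventually_hasSlopes x)).exists
  exact hy.2 (by rw [ha.omega_one, sub_self])

lemma affine_of_hasSlopes {h : ℝ → ℝ} {R : ℝ}
    (hh : ∀ x ∈ Set.Ioo (-R) R, ∃ a, HasSlopes h x a a) :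
    ∃ c d, ∀ x ∈ Set.Ioo (-R) R, h x = c + d * x := by
  have hder : ∀ {x a : ℝ}, HasSlopes h x a a → HasDerivAt h a x := by
    intro x a ha
    have hd : HasDerivAt (fun y => h x + a * (y - x)) a x := by
      simpa using (((hasDerivAt_id x).sub_const x).const_mul a).const_add (h x)
    exact hd.congr_of_eventuallyEq ha.eventually_nhds
  have hder2 : ∀ x ∈ Set.Ioo (-R) R, HasDerivAt (deriv h) 0 x := by
    intro x hx
    obtain ⟨a, ha⟩ := hh x hx
    refine (hasDerivAt_const x a).congr_of_eventuallyEq ?_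
    filter_upwards [ha.eventually_nhds.eventually_nhds] with y hy
    have hd : HasDerivAt (fun y => h x + a * (y - x)) a y := by
      simpa using (((hasDerivAt_id y).sub_const x).const_mul a).const_add (h x)
    exact (hd.congr_of_eventuallyEq hy).deriv
  obtain ⟨d, hd⟩ := isOpen_Ioo.exists_is_const_of_deriv_eq_zero isPreconnected_Ioo
    (fun x hx => (hder2 x hx).differentiableAt.differentiableWithinAt)
    (fun x hx => (hder2 x hx).deriv)
  have hder3 : ∀ x ∈ Set.Ioo (-R) R, HasDerivAt (fun y => h y - d * y) 0 x := by
    intro x hx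
    obtain ⟨a, ha⟩ := hh x hx
    have h1 : a = d := by rw [← hd x hx, (hder ha).deriv]
    have h2 := (hder ha).fun_sub ((hasDerivAt_id x).const_mul d)
    simpa [h1] using h2
  obtain ⟨c, hc⟩ := isOpen_Ioo.exists_is_const_of_deriv_eq_zero isPreconnected_Ioo
    (fun x hx => (hder3 x hx).differentiableAt.differentiableWithinAt)
    (fun x hx => (hder3 x hx).deriv)
  refine ⟨c, d, fun x hx => ?_⟩
  have := hc x hx
  linarith

/-- On a bounded interval a piecewise linear function is an affine function plus a combination of
the ramps `max (x - z) 0` at its breakpoints `z`, with the slope jumps as coefficients. Both the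
convexity of tropical entire functions and the tropical Jensen formula are read off from this. -/
lemma IsPiecewiseLinear.exists_ramp_decomposition {g : ℝ → ℝ} (hg : IsPiecewiseLinear g)
    (R : ℝ) :
    ∃ c d, ∀ x ∈ Set.Ioo (-R) R,
      g x = c + d * x + ∑ z ∈ (hg.finite_breakpoints R).toFinset, omega 1 g z * max (x - z) 0 := by
  set S := (hg.finite_breakpoints R).toFinset with hS
  obtain ⟨c, d, hcd⟩ := affine_of_hasSlopes (h := fun x => g x + ∑ z ∈ S,
    (-omega 1 g z) * max (x - z) 0) (R := R) (by
      intro x hx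
      obtain ⟨a, b, hab⟩ := hg x
      have h1 := hab.add (HasSlopes.sum S fun z _ => (hasSlopes_ramp z x).const_mul (-omega 1 g z))
      have h2 : (∑ z ∈ S, -omega 1 g z * (if z ≤ x then 1 else 0))
          = (∑ z ∈ S, -omega 1 g z * (if z < x then 1 else 0)) + (a - b) := by
        have h3 : ∀ z ∈ S, -omega 1 g z * (if z ≤ x then 1 else 0)
            = -omega 1 g z * (if z < x then 1 else 0) + if z = x then -omega 1 g z else 0 := by
          intro z _
          rcases lt_trichotomy z x with h | h | h
          · simp [h, h.le, h.ne]
          · simp [h]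
          · simp [h.not_ge, h.not_gt, h.ne']
        rw [Finset.sum_congr rfl h3, Finset.sum_add_distrib, Finset.sum_ite_eq']
        congr 1
        split_ifs with hx'
        · rw [hab.omega_one]; ring
        · have : omega 1 g x = 0 := by
            by_contra hne
            exact hx' (by simp [hS, hne, hx.1.le, hx.2.le])
          rw [hab.omega_one] at this
          linarith
      refine ⟨a + ∑ z ∈ S, -omega 1 g z * (if z < x then 1 else 0), ?_⟩
      rw [h2] at h1
      convert h1 using 1
      ring)
  refine ⟨c, d, fun x hx => ?_⟩
  have := hcd x hx
  simp only [neg_mul, Finset.sum_neg_distrib] at this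
  linarith

lemma convexOn_of_omega_nonneg {g : ℝ → ℝ} (hg : IsPiecewiseLinear g)
    (hω : ∀ x, 0 ≤ omega 1 g x) : ConvexOn ℝ Set.univ g := by
  refine ⟨convex_univ, fun x _ y _ a b ha hb hab => ?_⟩
  obtain ⟨c, d, hcd⟩ := hg.exists_ramp_decomposition (|x| + |y| + 1)
  set S := (hg.finite_breakpoints (|x| + |y| + 1)).toFinset
  have hx : x ∈ Set.Ioo (-(|x| + |y| + 1)) (|x| + |y| + 1) :=
    abs_lt.1 (by linarith [abs_nonneg y])
  have hy : y ∈ Set.Ioo (-(|x| + |y| + 1)) (|x| + |y| + 1) :=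
    abs_lt.1 (by linarith [abs_nonneg x])
  have hxy := (convex_Ioo (-(|x| + |y| + 1)) (|x| + |y| + 1)) hx hy ha hb hab
  rw [hcd x hx, hcd y hy, hcd _ hxy]
  simp only [smul_eq_mul]
  have key : ∑ z ∈ S, omega 1 g z * max (a * x + b * y - z) 0
      ≤ a * ∑ z ∈ S, omega 1 g z * max (x - z) 0 + b * ∑ z ∈ S, omega 1 g z * max (y - z) 0 := by
    rw [Finset.mul_sum, Finset.mul_sum, ← Finset.sum_add_distrib]
    refine Finset.sum_le_sum fun z _ => ?_
    have : max (a * x + b * y - z) 0 ≤ a * max (x - z) 0 + b * max (y - z) 0 := by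
      refine max_le ?_ (by positivity)
      have h1 := mul_le_mul_of_nonneg_left (le_max_left (x - z) 0) ha
      have h2 := mul_le_mul_of_nonneg_left (le_max_left (y - z) 0) hb
      have h3 : z = a * z + b * z := by rw [← add_mul, hab, one_mul]
      linarith
    have := mul_le_mul_of_nonneg_left this (hω z)
    linarith
  have h3 : c = a * c + b * c := by rw [← add_mul, hab, one_mul]
  linarith

/-! ### The tropical Jensen formula -/

/-- The symmetric second difference of `g` at the origin, with step `r`. -/
def jensen (g : ℝ → ℝ) (r : ℝ) : ℝ := 1 / 2 * (g r + g (-r)) - g 0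

lemma countingN_tropInv {g : ℝ → ℝ} (hg : IsPiecewiseLinear g)
    (hc : ConvexOn ℝ Set.univ g) {r : ℝ} (hr : 0 < r) :
    countingN 1 r (tropInv g) = jensen g r := by
  have hω : ∀ x, omega 1 (tropInv g) x = -omega 1 g x ∧ 0 ≤ omega 1 g x := by
    intro x
    obtain ⟨a, b, hab⟩ := hg x
    rw [hab.tropInv.omega_one, hab.omega_one]
    have := hab.le_of_convexOn hc
    constructor <;> linarith
  obtain ⟨c, d, hcd⟩ := hg.exists_ramp_decomposition (r + 1)
  set S := (hg.finite_breakpoints (r + 1)).toFinset with hS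
  have hset : {z : ℝ | z ∈ Set.Ioo (-r) r ∧ omega 1 (tropInv g) z < 0}
      = ↑(S.filter fun z => z ∈ Set.Ioo (-r) r) := by
    ext z
    simp only [Set.mem_ofPred_eq, (hω z).1, Finset.coe_filter, hS, Set.Finite.mem_toFinset,
      Set.mem_Ioo, Set.mem_Icc, neg_lt_zero]
    constructor
    · rintro ⟨⟨h1, h2⟩, h3⟩
      exact ⟨⟨⟨by linarith, by linarith⟩, h3.ne'⟩, h1, h2⟩
    · rintro ⟨⟨-, h3⟩, h1, h2⟩
      exact ⟨⟨h1, h2⟩, lt_of_le_of_ne (hω z).2 h3.symm⟩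
  have hsum : ∑ᶠ z ∈ {z : ℝ | z ∈ Set.Ioo (-r) r ∧ omega 1 (tropInv g) z < 0},
      |omega 1 (tropInv g) z| * (r - |z|) ^ 1
      = ∑ z ∈ S, omega 1 g z * max (r - |z|) 0 := by
    rw [hset, finsum_mem_coe_finset, Finset.sum_filter]
    refine Finset.sum_congr rfl fun z _ => ?_
    rw [(hω z).1, abs_neg, abs_of_nonneg (hω z).2, pow_one]
    split_ifs with h
    · rw [max_eq_left (by linarith [abs_lt.2 h])]
    · rw [max_eq_right, mul_zero]
      by_contra hlt
      exact h (abs_lt.1 (by linarith))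
  have hramp : ∀ z : ℝ, max (r - z) 0 + max (-r - z) 0 - 2 * max (0 - z) 0 = max (r - |z|) 0 := by
    intro z
    rcases le_total z 0 with h | h
    · rw [abs_of_nonpos h, max_eq_left (by linarith : 0 ≤ r - z),
        max_eq_left (by linarith : 0 ≤ 0 - z)]
      rcases le_total (-r - z) 0 with h' | h'
      · rw [max_eq_right h', max_eq_left (by linarith)]; ring
      · rw [max_eq_left h', max_eq_right (by linarith)]; ring
    · rw [abs_of_nonneg h, max_eq_right (by linarith : -r - z ≤ 0),
        max_eq_right (by linarith : 0 - z ≤ 0)]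
      ring
  rw [countingN, hsum, jensen, hcd r ⟨by linarith, by linarith⟩,
    hcd (-r) ⟨by linarith, by linarith⟩, hcd 0 ⟨by linarith, by linarith⟩]
  have hterm : ∑ z ∈ S, omega 1 g z * max (r - |z|) 0
      = ∑ z ∈ S, omega 1 g z * max (r - z) 0 + ∑ z ∈ S, omega 1 g z * max (-r - z) 0
        - 2 * ∑ z ∈ S, omega 1 g z * max (0 - z) 0 := by
    rw [Finset.mul_sum, ← Finset.sum_add_distrib, ← Finset.sum_sub_distrib]
    refine Finset.sum_congr rfl fun z _ => ?_
    rw [← hramp z]; ring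
  rw [hterm]
  ring

/-! ### Tropical entire functions of order at most one -/

lemma IsMeromorphic.exists_hasSlopes {n : ℕ} (hn : n ≤ 1) {g : ℝ → ℝ} (hg : IsMeromorphic n g)
    (x : ℝ) : ∃ a b, HasSlopes g x a b ∧ (n = 0 → a = b) := by
  obtain ⟨t, p, hmono, htop, hbot, hdeg, -, heq⟩ := hg
  have hpiece : ∀ i, ∀ y ∈ Set.Icc (t i) (t (i + 1)), g y = (p i).coeff 1 * y + (p i).coeff 0 := by
    intro i y hy
    rw [heq i y hy]
    conv_lhs => rw [Polynomial.eq_X_add_C_of_natDegree_le_one ((hdeg i).trans hn)]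
    simp
  have hzero : n = 0 → ∀ i, (p i).coeff 1 = 0 := fun h i =>
    Polynomial.coeff_eq_zero_of_natDegree_lt (by have := hdeg i; omega)
  obtain ⟨i, hi, hmax⟩ : ∃ i, t i ≤ x ∧ ∀ j, t j ≤ x → j ≤ i := by
    obtain ⟨B, hB⟩ := (htop.eventually_gt_atTop x).exists_forall_of_atTop
    obtain ⟨A, hA⟩ := (hbot.eventually_le_atBot x).exists
    exact Int.exists_greatest_of_bdd
      ⟨B, fun j hj => le_of_not_ge fun h => (hB j h).not_ge hj⟩ ⟨A, hA⟩
  have hi' : x < t (i + 1) := by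
    by_contra h
    have := hmax _ (not_lt.1 h)
    omega
  have hright : ∀ᶠ y in 𝓝[>] x, g y = g x + (p i).coeff 1 * (y - x) := by
    filter_upwards [Ioo_mem_nhdsGT hi'] with y hy
    rw [hpiece i y ⟨by linarith [hy.1], hy.2.le⟩, hpiece i x ⟨hi, hi'.le⟩]
    ring
  rcases hi.lt_or_eq with hlt | heq'
  · refine ⟨(p i).coeff 1, (p i).coeff 1, ⟨?_, hright⟩, fun _ => rfl⟩
    filter_upwards [Ioo_mem_nhdsLT hlt] with y hy
    rw [hpiece i y ⟨hy.1.le, by linarith [hy.2]⟩, hpiece i x ⟨hi, hi'.le⟩]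
    ring
  · refine ⟨(p (i - 1)).coeff 1, (p i).coeff 1, ⟨?_, hright⟩, fun h => by
      rw [hzero h, hzero h]⟩
    have hlt : t (i - 1) < x := heq' ▸ hmono (by omega)
    have hx : x = t (i - 1 + 1) := by rw [sub_add_cancel, heq']
    filter_upwards [Ioo_mem_nhdsLT hlt] with y hy
    rw [hpiece (i - 1) y ⟨hy.1.le, by linarith [hy.2]⟩, hpiece (i - 1) x ⟨hlt.le, hx.le⟩]
    ring

lemma IsEntire.isPiecewiseLinear {n : ℕ} (hn : n ≤ 1) {g : ℝ → ℝ} (hg : IsEntire n g) :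
    IsPiecewiseLinear g := fun x => by
  obtain ⟨a, b, h, -⟩ := hg.1.exists_hasSlopes hn x
  exact ⟨a, b, h⟩

lemma IsEntire.convexOn {n : ℕ} (hn : n ≤ 1) {g : ℝ → ℝ} (hg : IsEntire n g) :
    ConvexOn ℝ Set.univ g := by
  refine convexOn_of_omega_nonneg (hg.isPiecewiseLinear hn) fun x => ?_
  rcases Nat.le_one_iff_eq_zero_or_eq_one.1 hn with h0 | h1
  · obtain ⟨a, b, h, hab⟩ := hg.1.exists_hasSlopes hn x
    rw [h.omega_one, hab h0, sub_self]
  · exact not_lt.1 (hg.2 1 (by simp [h1]) x)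

lemma IsPiecewiseLinear.finset_sup' {ι : Type*} (s : Finset ι) (hs : s.Nonempty) {G : ι → ℝ → ℝ}
    (hG : ∀ i ∈ s, IsPiecewiseLinear (G i)) :
    IsPiecewiseLinear fun x => s.sup' hs fun i => G i x := by
  classical
  induction hs using Finset.Nonempty.cons_induction with
  | singleton i => simpa using hG i
  | cons i s hi hs ih =>
    intro x
    obtain ⟨a, b, hab⟩ := hG i (by simp) x
    obtain ⟨a', b', hab'⟩ := ih (fun j hj => hG j (by simp [hj])) x
    simpa only [Finset.sup'_cons hs] using hab.sup hab'

lemma convexOn_finset_sup' {ι : Type*} (s : Finset ι) (hs : s.Nonempty) {G : ι → ℝ → ℝ}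
    (hG : ∀ i ∈ s, ConvexOn ℝ Set.univ (G i)) :
    ConvexOn ℝ Set.univ fun x => s.sup' hs fun i => G i x := by
  refine ⟨convex_univ, fun x hx y hy a b ha hb hab => ?_⟩
  refine Finset.sup'_le _ _ fun i hi => ((hG i hi).2 hx hy ha hb hab).trans ?_
  have h1 := Finset.le_sup' (fun i => G i x) hi
  have h2 := Finset.le_sup' (fun i => G i y) hi
  simp only [smul_eq_mul]
  gcongr

/-! ### The tropical Casoratian -/

section Casoratian

variable {m : ℕ} {F : Fin (m + 1) → ℝ → ℝ}

lemma isPiecewiseLinear_casoratian (hF : ∀ i, IsPiecewiseLinear (F i)) :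
    IsPiecewiseLinear (casoratian F) := by
  refine IsPiecewiseLinear.finset_sup' _ _ fun π _ x => ?_
  choose a b hab using fun i => hF i (x + ((π i : ℕ) : ℝ))
  exact ⟨_, _, HasSlopes.sum Finset.univ fun i _ => (hab i).comp_add_const _⟩

lemma convexOn_casoratian (hF : ∀ i, ConvexOn ℝ Set.univ (F i)) :
    ConvexOn ℝ Set.univ (casoratian F) := by
  refine convexOn_finset_sup' _ _ fun π _ => ?_
  refine ⟨convex_univ, fun x _ y _ a b ha hb hab => ?_⟩
  simp only [smul_eq_mul, Finset.mul_sum]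
  rw [← Finset.sum_add_distrib]
  refine Finset.sum_le_sum fun i _ => ?_
  have := (hF i).2 (Set.mem_univ (x + ((π i : ℕ) : ℝ))) (Set.mem_univ (y + ((π i : ℕ) : ℝ)))
    ha hb hab
  simp only [smul_eq_mul] at this
  convert this using 2
  linear_combination -((π i : ℕ) : ℝ) * hab

end Casoratian

/-! ### A growth lemma of Borel type -/

lemma integral_shift_sub_le {φ : ℝ → ℝ} (hφ : Monotone φ) (hφ0 : ∀ x, 0 ≤ φ x) {a b h : ℝ}
    (hh : 0 ≤ h) :
    ∫ r in a..b, (φ (r + h) - φ r) ≤ h * φ (b + h) := by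
  have hint : ∀ u v, IntervalIntegrable φ volume u v := fun u v => hφ.intervalIntegrable
  have hint' : IntervalIntegrable (fun r => φ (r + h)) volume a b :=
    (hφ.comp (fun x y hxy => by simpa using hxy : Monotone fun r : ℝ => r + h)).intervalIntegrable
  rw [intervalIntegral.integral_sub hint' (hint _ _), intervalIntegral.integral_comp_add_right]
  have e1 := intervalIntegral.integral_add_adjacent_intervals (hint a (a + h)) (hint (a + h) (b + h))
  have e2 := intervalIntegral.integral_add_adjacent_intervals (hint a b) (hint b (b + h))
  have h1 : 0 ≤ ∫ r in a..(a + h), φ r :=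
    intervalIntegral.integral_nonneg (by linarith) fun x _ => hφ0 x
  have h2 : ∫ r in b..(b + h), φ r ≤ ∫ _ in b..(b + h), φ (b + h) :=
    intervalIntegral.integral_mono_on (by linarith) (hint _ _) intervalIntegrable_const
      fun x hx => hφ hx.2
  rw [intervalIntegral.integral_const, smul_eq_mul, add_sub_cancel_left] at h2
  linarith

/-- A nondecreasing function of polynomial growth `x ^ ρ` with `ρ < 1 - s` rarely gains more than a
fixed amount over the interval from `r` to `r + r ^ s`. On the dyadic block `[a, 2a)` the increment
over a step of constant length `(2a) ^ s` has integral `O(a ^ (s + ρ))` by telescoping, so the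
exceptional set has there logarithmic measure `O(a ^ (s + ρ - 1))`, which is summable over
`a = 2 ^ k`. -/
lemma finiteLogMeasure_increment {φ : ℝ → ℝ} (hφ : Monotone φ) (hφ0 : ∀ x, 0 ≤ φ x)
    {K ρ s δ : ℝ} (hK : 0 ≤ K) (hφK : ∀ x, 1 ≤ x → φ x ≤ K * x ^ ρ) (hρ : 0 < ρ) (hs : 0 < s)
    (hsρ : s + ρ < 1) (hδ : 0 < δ) :
    FiniteLogMeasure {r | δ < φ (r + r ^ s) - φ r} := by
  set E := {r : ℝ | δ < φ (r + r ^ s) - φ r} with hE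
  have hEm : MeasurableSet E := by
    refine measurableSet_lt measurable_const ?_
    exact (hφ.measurable.comp (measurable_id.add (measurable_id.pow_const s))).sub hφ.measurable
  refine ⟨hEm, ?_⟩
  set q : ℝ := 2 ^ (s + ρ - 1) with hq
  have hq0 : 0 < q := Real.rpow_pos_of_pos two_pos _
  have hq1 : q < 1 := Real.rpow_lt_one_of_one_lt_of_neg one_lt_two (by linarith)
  set C : ℝ := 2 ^ s * (K * 4 ^ ρ) / δ with hC
  have hC0 : 0 ≤ C := by positivity
  have hblock : ∀ k : ℕ, ∫⁻ r in E ∩ Set.Ico ((2 : ℝ) ^ k) (2 ^ (k + 1)), ENNReal.ofReal (1 / r)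
      ≤ ENNReal.ofReal (C * q ^ k) := by
    intro k
    set a : ℝ := 2 ^ k with ha
    have ha1 : 1 ≤ a := one_le_pow₀ one_le_two
    have ha0 : 0 < a := by linarith
    have h2a : (2 : ℝ) ^ (k + 1) = 2 * a := by rw [ha]; ring
    set h : ℝ := (2 * a) ^ s with hh
    have hh0 : 0 ≤ h := by positivity
    have hh2 : h ≤ 2 * a := by
      rw [hh]
      conv_rhs => rw [← Real.rpow_one (2 * a)]
      exact Real.rpow_le_rpow_of_exponent_le (by linarith) (by linarith)
    have hnn : ∀ r, 0 ≤ (φ (r + h) - φ r) / (a * δ) := fun r =>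
      div_nonneg (sub_nonneg.2 (hφ (by linarith))) (by positivity)
    have hint : IntervalIntegrable (fun r => φ (r + h) - φ r) volume a (2 * a) :=
      ((hφ.comp (fun x y hxy => by simpa using hxy : Monotone fun r : ℝ => r + h)
        ).intervalIntegrable).sub hφ.intervalIntegrable
    have hval : ∫ r in a..(2 * a), (φ (r + h) - φ r) / (a * δ) ≤ C * q ^ k := by
      rw [intervalIntegral.integral_div]
      have h1 := integral_shift_sub_le (a := a) (b := 2 * a) hφ hφ0 hh0
      have h2 : φ (2 * a + h) ≤ K * (4 * a) ^ ρ :=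
        (hφ (by linarith : 2 * a + h ≤ 4 * a)).trans (hφK _ (by linarith))
      have h3 : q ^ k = a ^ s * a ^ ρ / a := by
        rw [← Real.rpow_add ha0, ← Real.rpow_sub_one ha0.ne', hq, ha, ← Real.rpow_natCast,
          ← Real.rpow_natCast, ← Real.rpow_mul two_pos.le, ← Real.rpow_mul two_pos.le, mul_comm]
      calc (∫ r in a..(2 * a), (φ (r + h) - φ r)) / (a * δ)
          ≤ h * (K * (4 * a) ^ ρ) / (a * δ) := by
            gcongr
            exact h1.trans (mul_le_mul_of_nonneg_left h2 hh0)
        _ = C * q ^ k := by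
            rw [h3, hh, hC, Real.mul_rpow two_pos.le ha0.le,
              Real.mul_rpow (by norm_num) ha0.le]
            field_simp
    calc ∫⁻ r in E ∩ Set.Ico a (2 ^ (k + 1)), ENNReal.ofReal (1 / r)
        ≤ ∫⁻ r in E ∩ Set.Ico a (2 ^ (k + 1)), ENNReal.ofReal ((φ (r + h) - φ r) / (a * δ)) := by
          refine setLIntegral_mono' (hEm.inter measurableSet_Ico) fun r hr => ?_
          refine ENNReal.ofReal_le_ofReal ?_
          rw [h2a] at hr
          have hr1 : a ≤ r := hr.2.1
          have hr2 : r ^ s ≤ h := Real.rpow_le_rpow (by linarith) hr.2.2.le hs.le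
          have hr3 : δ < φ (r + r ^ s) - φ r := hr.1
          have hr4 : φ (r + r ^ s) ≤ φ (r + h) := hφ (by linarith)
          calc 1 / r ≤ 1 / a := one_div_le_one_div_of_le ha0 hr1
            _ = δ / (a * δ) := by field_simp
            _ ≤ _ := by gcongr; linarith
      _ ≤ ∫⁻ r in Set.Ioc a (2 * a), ENNReal.ofReal ((φ (r + h) - φ r) / (a * δ)) := by
          rw [h2a]
          refine (lintegral_mono_set Set.inter_subset_right).trans_eq ?_
          rw [Measure.restrict_congr_set Ico_ae_eq_Ioc]
      _ = ENNReal.ofReal (∫ r in Set.Ioc a (2 * a), (φ (r + h) - φ r) / (a * δ)) := by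
          rw [ofReal_integral_eq_lintegral_ofReal]
          · exact ((intervalIntegrable_iff_integrableOn_Ioc_of_le (by linarith)).1 hint).div_const _
          · exact Eventually.of_forall hnn
      _ ≤ ENNReal.ofReal (C * q ^ k) := by
          rw [← intervalIntegral.integral_of_le (by linarith)]
          exact ENNReal.ofReal_le_ofReal hval
  have hcover : E ∩ Set.Ici 1 ⊆ ⋃ k : ℕ, E ∩ Set.Ico ((2 : ℝ) ^ k) (2 ^ (k + 1)) := by
    rintro r ⟨hr, hr1⟩
    obtain ⟨k, hk⟩ := exists_nat_pow_near (show (1 : ℝ) ≤ r from hr1) one_lt_two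
    exact Set.mem_iUnion.2 ⟨k, hr, hk.1, hk.2⟩
  have hsum : Summable fun k : ℕ => C * q ^ k :=
    (summable_geometric_of_lt_one hq0.le hq1).mul_left C
  calc ∫⁻ r in E ∩ Set.Ici 1, ENNReal.ofReal (1 / r)
      ≤ ∫⁻ r in ⋃ k : ℕ, E ∩ Set.Ico ((2 : ℝ) ^ k) (2 ^ (k + 1)), ENNReal.ofReal (1 / r) :=
        lintegral_mono_set hcover
    _ ≤ ∑' k : ℕ, ∫⁻ r in E ∩ Set.Ico ((2 : ℝ) ^ k) (2 ^ (k + 1)), ENNReal.ofReal (1 / r) :=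
        lintegral_iUnion_le _ _
    _ ≤ ∑' k : ℕ, ENNReal.ofReal (C * q ^ k) := ENNReal.tsum_le_tsum hblock
    _ = ENNReal.ofReal (∑' k : ℕ, C * q ^ k) :=
        (ENNReal.ofReal_tsum_of_nonneg (fun k => by positivity) hsum).symm
    _ < ⊤ := ENNReal.ofReal_lt_top

lemma finiteLogMeasure_empty : FiniteLogMeasure ∅ := ⟨MeasurableSet.empty, by simp⟩

/-- If `log T` grows at most like `r ^ ρ` and `s + ρ < 1`, then `T` at most doubles from `r` to
`r + r ^ s`, outside a set of finite logarithmic measure. -/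
lemma exists_finiteLogMeasure_le_two_mul {T : ℝ → ℝ} {r₀ ρ s : ℝ} (hr₀ : 1 ≤ r₀)
    (hmono : MonotoneOn T (Set.Ici r₀)) (hT1 : ∀ r, r₀ ≤ r → 1 ≤ T r)
    (hTρ : ∀ r, r₀ ≤ r → Real.log (T r) ≤ r ^ ρ) (hρ : 0 < ρ) (hs : 0 < s) (hsρ : s + ρ < 1) :
    ∃ E, FiniteLogMeasure E ∧ ∀ r, r₀ ≤ r → r ∉ E → T (r + r ^ s) ≤ 2 * T r := by
  set φ : ℝ → ℝ := fun x => Real.log (T (max x r₀)) with hφ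
  have hφm : Monotone φ := fun x y hxy => by
    refine Real.log_le_log (by linarith [hT1 _ (le_max_right x r₀)]) ?_
    exact hmono (Set.mem_Ici.2 (le_max_right _ _)) (Set.mem_Ici.2 (le_max_right _ _))
      (max_le_max_right _ hxy)
  refine ⟨_, finiteLogMeasure_increment (K := r₀ ^ ρ) (δ := Real.log 2) hφm
    (fun x => Real.log_nonneg (hT1 _ (le_max_right _ _))) (by positivity) (fun x hx => ?_) hρ hs hsρ
    (Real.log_pos one_lt_two), fun r hr hrE => ?_⟩
  · rw [← Real.mul_rpow (by linarith) (by linarith)]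
    refine (hTρ _ (le_max_right _ _)).trans (Real.rpow_le_rpow (by positivity) ?_ hρ.le)
    exact max_le (by nlinarith) (by nlinarith)
  · have hrs : r₀ ≤ r + r ^ s := by linarith [Real.rpow_nonneg (by linarith : 0 ≤ r) s]
    have h1 := hT1 r hr
    have h2 := hT1 _ hrs
    simp only [Set.mem_ofPred_eq, not_lt, hφ, max_eq_left hr, max_eq_left hrs] at hrE
    rw [← Real.log_le_log_iff (by linarith) (by linarith), Real.log_mul two_ne_zero (by linarith)]
    linarith

/-! ### Slopes of convex functions -/

lemma slope_le_slope {g : ℝ → ℝ} (hg : ConvexOn ℝ Set.univ g) {x y u v : ℝ} (hxy : x < y)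
    (huv : u < v) (hxu : x ≤ u) (hyv : y ≤ v) :
    (g y - g x) / (y - x) ≤ (g v - g u) / (v - u) := by
  have h1 := hg.secant_mono (Set.mem_univ x) (Set.mem_univ y) (Set.mem_univ v) hxy.ne'
    (by linarith : x < v).ne' hyv
  have h2 := hg.secant_mono (Set.mem_univ v) (Set.mem_univ x) (Set.mem_univ u)
    (by linarith : x < v).ne huv.ne hxu
  rw [← neg_sub (g v) (g x), ← neg_sub v x, neg_div_neg_eq, ← neg_sub (g v) (g u), ← neg_sub v u,
    neg_div_neg_eq] at h2
  exact h1.trans h2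

lemma convexOn_jensen {g : ℝ → ℝ} (hg : ConvexOn ℝ Set.univ g) :
    ConvexOn ℝ Set.univ (jensen g) := by
  refine ⟨convex_univ, fun x _ y _ a b ha hb hab => ?_⟩
  have h1 := hg.2 (Set.mem_univ x) (Set.mem_univ y) ha hb hab
  have h2 := hg.2 (Set.mem_univ (-x)) (Set.mem_univ (-y)) ha hb hab
  rw [show a • -x + b • -y = -(a • x + b • y) by simp only [smul_eq_mul]; ring] at h2
  simp only [jensen, smul_eq_mul] at *
  have h3 : g 0 = a * g 0 + b * g 0 := by rw [← add_mul, hab, one_mul]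
  linarith

lemma jensen_zero (g : ℝ → ℝ) : jensen g 0 = 0 := by simp [jensen]; ring

lemma jensen_neg (g : ℝ → ℝ) (r : ℝ) : jensen g (-r) = jensen g r := by
  simp [jensen, add_comm]

lemma jensen_nonneg {g : ℝ → ℝ} (hg : ConvexOn ℝ Set.univ g) (r : ℝ) : 0 ≤ jensen g r := by
  have h := hg.2 (Set.mem_univ r) (Set.mem_univ (-r)) (by norm_num : (0 : ℝ) ≤ 1 / 2)
    (by norm_num : (0 : ℝ) ≤ 1 / 2) (by norm_num)
  simp only [smul_eq_mul] at h
  rw [show 1 / 2 * r + 1 / 2 * -r = 0 by ring] at h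
  simp only [jensen]
  linarith

lemma jensen_div_mul_le {g : ℝ → ℝ} (hg : ConvexOn ℝ Set.univ g) {x y : ℝ} (hx : 0 < x)
    (hxy : x ≤ y) : jensen g x / x * y ≤ jensen g y := by
  have h := slope_le_slope (convexOn_jensen hg) hx (hx.trans_le hxy) le_rfl hxy
  simp only [jensen_zero, sub_zero] at h
  rwa [← le_div_iff₀ (hx.trans_le hxy)]

lemma monotoneOn_jensen {g : ℝ → ℝ} (hg : ConvexOn ℝ Set.univ g) :
    MonotoneOn (jensen g) (Set.Ioi 0) := by
  intro x hx y _ hxy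
  have hx0 : 0 < x := hx
  refine le_trans ?_ (jensen_div_mul_le hg hx0 hxy)
  rw [div_mul_eq_mul_div, le_div_iff₀ hx0]
  exact mul_le_mul_of_nonneg_left hxy (jensen_nonneg hg x)

lemma affine_of_jensen_eq_zero {g : ℝ → ℝ} (hg : ConvexOn ℝ Set.univ g)
    (h0 : ∀ r, jensen g r = 0) : ∃ a, ∀ x, g x = g 0 + a * x := by
  -- The slope of the chord from the origin is nondecreasing and even, hence constant.
  have hmono : ∀ {x y : ℝ}, x ≠ 0 → y ≠ 0 → x ≤ y → (g x - g 0) / x ≤ (g y - g 0) / y := by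
    intro x y hx hy hxy
    simpa using hg.secant_mono (Set.mem_univ 0) (Set.mem_univ x) (Set.mem_univ y) hx hy hxy
  have hconst : ∀ x, x ≠ 0 → (g x - g 0) / x = (g 1 - g 0) / 1 := by
    intro x hx
    have hz : 0 < max |x| 1 := lt_max_of_lt_right one_pos
    have hx1 : x ≤ max |x| 1 := (le_abs_self x).trans (le_max_left _ _)
    have hx2 : -max |x| 1 ≤ x := by linarith [neg_abs_le x, le_max_left |x| 1]
    have h1 : (1 : ℝ) ≤ max |x| 1 := le_max_right _ _
    have heven : (g (-max |x| 1) - g 0) / (-max |x| 1) = (g (max |x| 1) - g 0) / max |x| 1 := by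
      have h := h0 (max |x| 1)
      simp only [jensen] at h
      rw [div_neg, ← neg_div]
      congr 1
      linarith
    have e1 := hmono hx hz.ne' hx1
    have e2 := hmono (neg_ne_zero.2 hz.ne') hx hx2
    have e3 := hmono one_ne_zero hz.ne' h1
    have e4 := hmono (neg_ne_zero.2 hz.ne') one_ne_zero (by linarith : -max |x| 1 ≤ 1)
    linarith
  refine ⟨(g 1 - g 0) / 1, fun x => ?_⟩
  rcases eq_or_ne x 0 with rfl | hx
  · simp
  · rw [← hconst x hx]
    field_simp
    ring

/-- A convex function below another one whose symmetric second differences vanish is affine, since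
its own symmetric second differences are bounded. -/
lemma affine_of_le {g G : ℝ → ℝ} (hg : ConvexOn ℝ Set.univ g) (hle : ∀ x, g x ≤ G x)
    (hG : ∀ r, 0 < r → jensen G r = 0) : ∃ a, ∀ x, g x = g 0 + a * x := by
  have hb : ∀ r, 0 < r → jensen g r ≤ G 0 - g 0 := by
    intro r hr
    have h := hG r hr
    simp only [jensen] at h ⊢
    linarith [hle r, hle (-r)]
  have hpos : ∀ r, 0 < r → jensen g r = 0 := by
    intro r hr
    refine le_antisymm ?_ (jensen_nonneg hg r)
    by_contra hlt
    rw [not_le] at hlt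
    have hB : 0 ≤ G 0 - g 0 := sub_nonneg.2 (hle 0)
    set y := r * ((G 0 - g 0 + jensen g r) / jensen g r) with hy
    have hry : r ≤ y := by
      rw [hy]
      refine le_mul_of_one_le_right hr.le ?_
      rw [one_le_div hlt]
      linarith
    have h1 := jensen_div_mul_le hg hr hry
    have h2 : jensen g r / r * y = G 0 - g 0 + jensen g r := by
      rw [hy]; field_simp
    linarith [hb y (hr.trans_le hry)]
  refine affine_of_jensen_eq_zero hg fun r => ?_
  rcases lt_trichotomy r 0 with h | h | h
  · rw [← jensen_neg]; exact hpos _ (by linarith)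
  · rw [h, jensen_zero]
  · exact hpos r h

/-- The increments of a convex function over `[r, r + k]` and `[-r, -r + k]` are controlled by the
slopes of chords further out, of horizontal length `R - r`, on one side and by the slopes of chords
near the origin on the other. -/
lemma abs_increment_le {g : ℝ → ℝ} (hg : ConvexOn ℝ Set.univ g) {k r R B : ℝ} (hk : 0 ≤ k)
    (hkr : k ≤ r) (hkR : r + k ≤ R) (hrR : r < R) (hR : |g R| ≤ B) (hR' : |g (-R)| ≤ B)
    (hB : |g r| ≤ B) (hB' : |g (-r)| ≤ B) :
    |g (r + k) - g r| ≤ k * (|g 1 - g 0| + |g 0 - g (-1)| + 2 * B / (R - r)) ∧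
      |g (-r + k) - g (-r)| ≤ k * (|g 1 - g 0| + |g 0 - g (-1)| + 2 * B / (R - r)) := by
  have hRr : 0 < R - r := by linarith
  have hB0 : 0 ≤ 2 * B / (R - r) := div_nonneg (by linarith [abs_nonneg (g R)]) hRr.le
  rcases hk.eq_or_lt with rfl | hk0
  · simp
  have key : ∀ x, |(g (x + k) - g x) / (x + k - x)|
      ≤ |g 1 - g 0| + |g 0 - g (-1)| + 2 * B / (R - r) →
      |g (x + k) - g x| ≤ k * (|g 1 - g 0| + |g 0 - g (-1)| + 2 * B / (R - r)) := by
    intro x hx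
    rwa [add_sub_cancel_left, abs_div, abs_of_pos hk0, div_le_iff₀ hk0, mul_comm] at hx
  have a1 := abs_le.1 hR
  have a2 := abs_le.1 hR'
  have a3 := abs_le.1 hB
  have a4 := abs_le.1 hB'
  constructor
  · refine key r (abs_le.2 ⟨?_, ?_⟩)
    · have := slope_le_slope hg (by norm_num : (-1 : ℝ) < 0) (by linarith : r < r + k)
        (by linarith) (by linarith)
      norm_num at this
      linarith [abs_nonneg (g 1 - g 0), neg_abs_le (g 0 - g (-1)), this,
        show (g (r + k) - g r) / (r + k - r) = (g (r + k) - g r) / k by rw [add_sub_cancel_left]]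
    · have h1 := slope_le_slope hg (by linarith : r < r + k) hrR le_rfl hkR
      have h2 : (g R - g r) / (R - r) ≤ 2 * B / (R - r) := by gcongr; linarith
      linarith [abs_nonneg (g 1 - g 0), abs_nonneg (g 0 - g (-1))]
  · refine key (-r) (abs_le.2 ⟨?_, ?_⟩)
    · have h1 := slope_le_slope hg (by linarith : -R < -r) (by linarith : -r < -r + k)
        (by linarith) (by linarith)
      have h2 : -(2 * B / (R - r)) ≤ (g (-r) - g (-R)) / (-r - -R) := by
        rw [show -r - -R = R - r by ring, ← neg_div]
        gcongr
        linarith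
      linarith [abs_nonneg (g 1 - g 0), abs_nonneg (g 0 - g (-1))]
    · have := slope_le_slope hg (by linarith : -r < -r + k) (by norm_num : (0 : ℝ) < 1)
        (by linarith) (by linarith)
      rw [sub_zero, div_one] at this
      linarith [abs_nonneg (g 0 - g (-1)), le_abs_self (g 1 - g 0)]

/-! ### Comparing the Casoratian with the sum of the components -/

section Curve

variable {m : ℕ} {F : Fin (m + 1) → ℝ → ℝ}

lemma abs_casoratian_sub_sum_le {x D : ℝ}
    (h : ∀ i, ∀ k : ℕ, k ≤ m → |F i (x + k) - F i x| ≤ D) :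
    |casoratian F x - ∑ i, F i x| ≤ (m + 1) * D := by
  have hsum : ∀ π : Equiv.Perm (Fin (m + 1)),
      |∑ i, F i (x + ((π i : ℕ) : ℝ)) - ∑ i, F i x| ≤ (m + 1) * D := by
    intro π
    rw [← Finset.sum_sub_distrib]
    refine (Finset.abs_sum_le_sum_abs _ _).trans ?_
    refine (Finset.sum_le_card_nsmul _ _ D fun i _ => h i _ (by omega)).trans_eq ?_
    simp
  rw [abs_le]
  constructor
  · have h1 := (abs_le.1 (hsum 1)).1
    have h2 := Finset.le_sup' (fun π : Equiv.Perm (Fin (m + 1)) => ∑ i, F i (x + ((π i : ℕ) : ℝ)))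
      (Finset.mem_univ 1)
    change _ ≤ casoratian F x at h2
    linarith
  · rw [sub_le_iff_le_add]
    refine Finset.sup'_le _ _ fun π _ => ?_
    linarith [(abs_le.1 (hsum π)).2]

lemma jensen_casoratian_of_affine (hF : ∀ i, ∃ a, ∀ x, F i x = F i 0 + a * x) (r : ℝ) :
    jensen (casoratian F) r = 0 := by
  choose a ha using hF
  have hle : ∀ x y, casoratian F x ≤ casoratian F y + (∑ i, a i) * (x - y) := by
    intro x y
    refine Finset.sup'_le _ _ fun π _ => ?_
    have h := Finset.le_sup' (fun π : Equiv.Perm (Fin (m + 1)) => ∑ i, F i (y + ((π i : ℕ) : ℝ)))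
      (Finset.mem_univ π)
    change _ ≤ casoratian F y at h
    refine le_trans (le_of_eq ?_) (add_le_add_left h _)
    rw [Finset.sum_mul, ← Finset.sum_add_distrib]
    refine Finset.sum_congr rfl fun i _ => ?_
    rw [ha i (x + _), ha i (y + _)]
    ring
  simp only [jensen]
  linarith [hle r 0, hle 0 r, hle (-r) 0, hle 0 (-r)]

/-- The maximum of the components of a reduced representation. -/
def maxComp (F : Fin (m + 1) → ℝ → ℝ) (x : ℝ) : ℝ :=
  Finset.univ.sup' Finset.univ_nonempty fun i => F i x

lemma le_maxComp (i : Fin (m + 1)) (x : ℝ) : F i x ≤ maxComp F x :=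
  Finset.le_sup' (fun i => F i x) (Finset.mem_univ i)

lemma convexOn_maxComp (hF : ∀ i, ConvexOn ℝ Set.univ (F i)) : ConvexOn ℝ Set.univ (maxComp F) :=
  convexOn_finset_sup' _ _ fun i _ => hF i

lemma neg_linear_le {g : ℝ → ℝ} (hg : ConvexOn ℝ Set.univ g) {x : ℝ} (hx : 1 ≤ x) :
    -((|g 0| + |g 1 - g 0| + |g 0 - g (-1)|) * x) ≤ g x ∧
      -((|g 0| + |g 1 - g 0| + |g 0 - g (-1)|) * x) ≤ g (-x) := by
  have hx0 : 0 < x := by linarith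
  have h0 : |g 0| ≤ |g 0| * x := le_mul_of_one_le_right (abs_nonneg _) hx
  constructor
  · have h := slope_le_slope hg (by norm_num : (-1 : ℝ) < 0) hx0 (by norm_num) hx0.le
    rw [sub_neg_eq_add, zero_add, div_one, sub_zero, le_div_iff₀ hx0] at h
    nlinarith [neg_abs_le (g 0), neg_abs_le (g 0 - g (-1)), abs_nonneg (g 1 - g 0)]
  · have h := slope_le_slope hg (by linarith : -x < 0) one_pos (by linarith) zero_le_one
    rw [zero_sub, neg_neg, sub_zero, div_one, div_le_iff₀ hx0] at h
    nlinarith [neg_abs_le (g 0), le_abs_self (g 1 - g 0), abs_nonneg (g 0 - g (-1))]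

/-- Once the characteristic function grows at least linearly it dominates every component on both
sides: it controls the maximum of the components from above, and a convex function is bounded below
by a linear one. -/
lemma exists_abs_le_mul_cartanT (hF : ∀ i, ConvexOn ℝ Set.univ (F i)) {c r₁ : ℝ} (hc : 0 < c)
    (hT : ∀ r, r₁ ≤ r → c * r ≤ cartanT F r) :
    ∃ A, 0 ≤ A ∧ ∀ i, ∀ r, 1 ≤ r → r₁ ≤ r →
      |F i r| ≤ A * cartanT F r ∧ |F i (-r)| ≤ A * cartanT F r := by
  set M := maxComp F with hM
  set L : ℝ := |M 0| + ∑ i, (|F i 0| + |F i 1 - F i 0| + |F i 0 - F i (-1)|) with hL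
  have hL0 : 0 ≤ L := by positivity
  refine ⟨2 + 3 * L / c, by positivity, fun i r hr hr1 => ?_⟩
  have hr0 : 0 < r := by linarith
  have hlow : ∀ i, -(L * r) ≤ F i r ∧ -(L * r) ≤ F i (-r) := by
    intro i
    have h := neg_linear_le (hF i) hr
    have h1 : |F i 0| + |F i 1 - F i 0| + |F i 0 - F i (-1)| ≤ L := by
      have := Finset.single_le_sum
        (f := fun i => |F i 0| + |F i 1 - F i 0| + |F i 0 - F i (-1)|) (s := Finset.univ)
        (fun i _ => by positivity) (Finset.mem_univ i)
      linarith [abs_nonneg (M 0)]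
    have h2 := mul_le_mul_of_nonneg_right h1 hr0.le
    exact ⟨by linarith, by linarith⟩
  have hM0 : M 0 ≤ L * r := by
    have h1 : |M 0| ≤ L := le_add_of_nonneg_right (by positivity)
    exact (le_abs_self _).trans (h1.trans (le_mul_of_one_le_right hL0 hr))
  have hTr : jensen M r = cartanT F r := rfl
  simp only [jensen] at hTr
  have hLT : L * r ≤ L / c * cartanT F r := by
    rw [div_mul_eq_mul_div, le_div_iff₀ hc]
    calc L * r * c = L * (c * r) := by ring
      _ ≤ _ := mul_le_mul_of_nonneg_left (hT r hr1) hL0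
  have hT0 : 0 ≤ cartanT F r := le_trans (by positivity) (hT r hr1)
  have e : (2 + 3 * L / c) * cartanT F r = 2 * cartanT F r + 3 * (L / c * cartanT F r) := by ring
  have hLr : 0 ≤ L * r := by positivity
  rw [e]
  have u1 : M r ≤ 2 * cartanT F r + 3 * (L * r) := by
    linarith [(hlow 0).2, le_maxComp (F := F) 0 (-r)]
  have u2 : M (-r) ≤ 2 * cartanT F r + 3 * (L * r) := by
    linarith [(hlow 0).1, le_maxComp (F := F) 0 r]
  constructor
  · exact abs_le.2 ⟨by linarith [(hlow i).1], by linarith [le_maxComp (F := F) i r]⟩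
  · exact abs_le.2 ⟨by linarith [(hlow i).2], by linarith [le_maxComp (F := F) i (-r)]⟩

/-- Where the characteristic function at most doubles from `r` to `r + r ^ s`, the counting
functions differ by `O(1 + T(r) / r ^ s)`. -/
lemma exists_abs_jensen_sub_le (hF : ∀ i, ConvexOn ℝ Set.univ (F i)) {c r₁ s : ℝ} (hc : 0 < c)
    (hT : ∀ r, r₁ ≤ r → c * r ≤ cartanT F r) (hs : 0 < s) :
    ∃ C, ∀ᶠ r in atTop, cartanT F (r + r ^ s) ≤ 2 * cartanT F r →
      |∑ i, jensen (F i) r - jensen (casoratian F) r| ≤ C * (1 + cartanT F r / r ^ s) := by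
  obtain ⟨A, hA0, hA⟩ := exists_abs_le_mul_cartanT hF hc hT
  set L : ℝ := ∑ i, (|F i 1 - F i 0| + |F i 0 - F i (-1)|) with hL
  have hL0 : 0 ≤ L := by positivity
  set D₀ : ℝ := |casoratian F 0 - ∑ i, F i 0| with hD₀
  have hLi : ∀ i, |F i 1 - F i 0| + |F i 0 - F i (-1)| ≤ L := fun i =>
    Finset.single_le_sum (f := fun i => |F i 1 - F i 0| + |F i 0 - F i (-1)|)
      (fun i _ => by positivity) (Finset.mem_univ i)
  refine ⟨(m + 1) * (m * (L + 4 * A)) + D₀, ?_⟩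
  filter_upwards [eventually_ge_atTop 1, eventually_ge_atTop r₁, eventually_ge_atTop (m : ℝ),
    (tendsto_rpow_atTop hs).eventually_ge_atTop (m + 1 : ℝ)] with r hr1 hrr hrm hrs hdouble
  have hr0 : 0 < r := by linarith
  have hp : 0 < r ^ s := Real.rpow_pos_of_pos hr0 s
  set T := cartanT F r with hTdef
  have hT0 : 0 ≤ T := jensen_nonneg (convexOn_maxComp hF) r
  have hQ : 0 ≤ T / r ^ s := by positivity
  set D : ℝ := m * (L + 4 * A * (T / r ^ s)) with hD
  have hinc : ∀ i, ∀ k : ℕ, k ≤ m →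
      |F i (r + k) - F i r| ≤ D ∧ |F i (-r + k) - F i (-r)| ≤ D := by
    intro i k hk
    have hk' : (k : ℝ) ≤ m := by exact_mod_cast hk
    have hAr := hA i r hr1 hrr
    have hAR := hA i (r + r ^ s) (by linarith) (by linarith)
    have hAR2 : A * cartanT F (r + r ^ s) ≤ 2 * A * T := by
      calc _ ≤ A * (2 * T) := mul_le_mul_of_nonneg_left hdouble hA0
        _ = _ := by ring
    have hAT : A * T ≤ 2 * A * T := by nlinarith [mul_nonneg hA0 hT0]
    have h := abs_increment_le (hF i) (k := k) (r := r) (R := r + r ^ s) (B := 2 * A * T)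
      (by positivity) (by linarith) (by linarith) (by linarith)
      (hAR.1.trans hAR2) (hAR.2.trans hAR2) (hAr.1.trans hAT) (hAr.2.trans hAT)
    have hbound : (k : ℝ) * (|F i 1 - F i 0| + |F i 0 - F i (-1)|
        + 2 * (2 * A * T) / (r + r ^ s - r)) ≤ D := by
      rw [hD, add_sub_cancel_left, show 2 * (2 * A * T) / r ^ s = 4 * A * (T / r ^ s) by ring]
      gcongr
      exact hLi i
    exact ⟨h.1.trans hbound, h.2.trans hbound⟩
  have h1 := abs_casoratian_sub_sum_le fun i k hk => (hinc i k hk).1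
  have h2 := abs_casoratian_sub_sum_le fun i k hk => (hinc i k hk).2
  have h3 : (m + 1 : ℝ) * D ≤ (m + 1) * (m * (L + 4 * A)) * (1 + T / r ^ s) := by
    have h : L + 4 * A * (T / r ^ s) ≤ (L + 4 * A) * (1 + T / r ^ s) := by
      nlinarith [mul_nonneg hA0 hQ, mul_nonneg hL0 hQ]
    calc (m + 1 : ℝ) * D ≤ (m + 1) * (m * ((L + 4 * A) * (1 + T / r ^ s))) := by
          rw [hD]
          gcongr
      _ = _ := by ring
  have h4 : D₀ ≤ D₀ * (1 + T / r ^ s) :=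
    le_mul_of_one_le_right (abs_nonneg _) (by linarith)
  have h5 : ∑ i, jensen (F i) r - jensen (casoratian F) r
      = (casoratian F 0 - ∑ i, F i 0) - 1 / 2 * (casoratian F r - ∑ i, F i r)
        - 1 / 2 * (casoratian F (-r) - ∑ i, F i (-r)) := by
    simp only [jensen, Finset.sum_sub_distrib, ← Finset.mul_sum, Finset.sum_add_distrib]
    ring
  rw [h5, add_mul, abs_le]
  have a1 := abs_le.1 h1
  have a2 := abs_le.1 h2
  have a3 := abs_le.1 hD₀.ge
  constructor <;> linarith [a1.1, a1.2, a2.1, a2.2, a3.1, a3.2]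

end Curve

/-! ### Asymptotics of the error term -/

lemma one_add_div_rpow_isLittleO {T : ℝ → ℝ} {c σ s : ℝ} (hc : 0 < c)
    (hT : ∀ᶠ r in atTop, c * r ≤ T r) (hσ : σ < 1) (hσs : σ < s) :
    (fun r : ℝ => 1 + T r / r ^ s) =o[atTop] fun r => T r / r ^ σ := by
  refine IsLittleO.add ?_ ?_
  · refine (isLittleO_const_left.2 (Or.inr ?_))
    refine tendsto_norm_atTop_atTop.comp ?_
    refine tendsto_atTop_mono' atTop ?_
      ((tendsto_rpow_atTop (by linarith : 0 < 1 - σ)).const_mul_atTop hc)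
    filter_upwards [hT, eventually_gt_atTop 0] with r hr hr0
    rw [Real.rpow_sub hr0, Real.rpow_one, ← mul_div_assoc]
    gcongr
  · simp only [div_eq_mul_inv]
    refine (isBigO_refl T atTop).mul_isLittleO ?_
    refine (isLittleO_of_tendsto' ?_ ?_)
    · filter_upwards [eventually_gt_atTop 0] with r hr h
      exact absurd h (inv_pos.2 (Real.rpow_pos_of_pos hr σ)).ne'
    · refine (tendsto_rpow_neg_atTop (by linarith : 0 < s - σ)).congr' ?_
      filter_upwards [eventually_gt_atTop 0] with r hr
      rw [neg_sub, Real.rpow_sub hr, inv_div_inv]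

/-- A hyper-order below `1 - σ` gives a bound `log T(r) ≤ r ^ ρ` with `ρ < 1 - σ`. -/
lemma exists_log_le_rpow {T : ℝ → ℝ} {σ : ℝ} (hT : Tendsto T atTop atTop)
    (hρ : hyperOrder T < 1) (hσρ : (σ : EReal) < 1 - hyperOrder T) :
    ∃ ρ, 0 < ρ ∧ ρ + σ < 1 ∧ ∀ᶠ r in atTop, Real.log (T r) ≤ r ^ ρ := by
  have hlt : hyperOrder T < ((1 - σ : ℝ) : EReal) := by
    generalize hyperOrder T = h at *
    induction h using EReal.rec with
    | bot => exact EReal.bot_lt_coe _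
    | top => exact absurd hρ (by simp)
    | coe h =>
      have : σ < 1 - h := by exact_mod_cast hσρ
      exact_mod_cast (by linarith : h < 1 - σ)
  obtain ⟨ρ, h1, h2⟩ := EReal.lt_iff_exists_real_btwn.1 hlt
  have hev := eventually_lt_of_limsup_lt h1
  have hlog : ∀ᶠ r in atTop, 1 < Real.log (T r) :=
    (Real.tendsto_log_atTop.comp hT).eventually_gt_atTop 1
  refine ⟨ρ, ?_, by linarith [EReal.coe_lt_coe_iff.1 h2], ?_⟩
  · obtain ⟨r, hr, hl, hr1⟩ := (hev.and (hlog.and (eventually_gt_atTop 1))).exists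
    exact (div_nonneg (Real.log_nonneg hl.le) (Real.log_nonneg hr1.le)).trans_lt
      (EReal.coe_lt_coe_iff.1 hr)
  · filter_upwards [hev, hlog, eventually_gt_atTop 1] with r hr hl hr1
    have h := EReal.coe_lt_coe_iff.1 hr
    rw [div_lt_iff₀ (Real.log_pos hr1)] at h
    rw [← Real.log_le_log_iff (by linarith) (Real.rpow_pos_of_pos (by linarith) _),
      Real.log_rpow (by linarith)]
    exact h.le

end TropNev

end

theorem corollary6p3 {m : ℕ} (hm : 1 ≤ m)
    (f : ℝ → TropNev.TropProj m) (F : Fin (m + 1) → ℝ → ℝ)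
    (hf : TropNev.IsReducedRep 1 f F)
    (hρ : TropNev.hyperOrder (TropNev.cartanT F) < 1)
    (σ : ℝ) (hσ : 0 < σ) (hσρ : (σ : EReal) < 1 - TropNev.hyperOrder (TropNev.cartanT F)) :
    ∃ E : Set ℝ, TropNev.FiniteLogMeasure E ∧
      (fun r : ℝ => ∑ i, TropNev.countingN 1 r (TropNev.tropInv (F i))
          - TropNev.countingN 1 r (TropNev.tropInv (TropNev.casoratian F)))
        =o[atTop ⊓ 𝓟 Eᶜ] (fun r : ℝ => TropNev.cartanT F r / r ^ σ) := by
  open TropNev in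
  obtain ⟨d, hd, hsup⟩ := hf.entire
  have hd1 : ∀ i, d i ≤ 1 := fun i => hsup ▸ Finset.le_sup (f := d) (Finset.mem_univ i)
  have hconv : ∀ i, ConvexOn ℝ Set.univ (F i) := fun i => (hd i).convexOn (hd1 i)
  have hpl : ∀ i, IsPiecewiseLinear (F i) := fun i => (hd i).isPiecewiseLinear (hd1 i)
  have hMconv := convexOn_maxComp hconv
  have hcount : ∀ r : ℝ, 0 < r → ∑ i, countingN 1 r (tropInv (F i))
      - countingN 1 r (tropInv (casoratian F))
      = ∑ i, jensen (F i) r - jensen (casoratian F) r := by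
    intro r hr
    rw [countingN_tropInv (isPiecewiseLinear_casoratian hpl) (convexOn_casoratian hconv) hr]
    simp only [fun i => countingN_tropInv (hpl i) (hconv i) hr]
  by_cases hT : ∀ r, 0 < r → cartanT F r = 0
  · -- If `T` vanishes, all components are affine and nothing has a root.
    refine ⟨∅, finiteLogMeasure_empty, ?_⟩
    have haff : ∀ i, ∃ a, ∀ x, F i x = F i 0 + a * x := fun i =>
      affine_of_le (hconv i) (le_maxComp i) hT
    refine (isLittleO_zero _ _).congr' ?_ EventuallyEq.rfl
    filter_upwards [mem_inf_of_left (eventually_gt_atTop (0 : ℝ))] with r hr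
    have h0 : ∀ i, jensen (F i) r = 0 := fun i => by
      obtain ⟨a, ha⟩ := haff i
      rw [jensen, ha r, ha (-r)]; ring
    rw [hcount r hr, jensen_casoratian_of_affine haff]
    simp [h0]
  · push Not at hT
    obtain ⟨r₁, hr₁, hne⟩ := hT
    have hpos : 0 < cartanT F r₁ := lt_of_le_of_ne (jensen_nonneg hMconv r₁) hne.symm
    set c := cartanT F r₁ / r₁ with hcdef
    have hc : 0 < c := div_pos hpos hr₁
    have hlin : ∀ r, r₁ ≤ r → c * r ≤ cartanT F r := fun r hr => jensen_div_mul_le hMconv hr₁ hr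
    have hlin' : ∀ᶠ r in atTop, c * r ≤ cartanT F r :=
      (eventually_ge_atTop r₁).mono hlin
    have htop : Tendsto (cartanT F) atTop atTop :=
      tendsto_atTop_mono' atTop hlin' (tendsto_id.const_mul_atTop hc)
    obtain ⟨ρ, hρ0, hρσ, hlog⟩ := exists_log_le_rpow htop hρ hσρ
    obtain ⟨s, hs1, hs2⟩ := exists_between (by linarith : σ < 1 - ρ)
    obtain ⟨r₀, hr₀⟩ := (hlog.and ((htop.eventually_ge_atTop 1).and
      (eventually_ge_atTop 1))).exists_forall_of_atTop
    obtain ⟨E, hE, hdouble⟩ := exists_finiteLogMeasure_le_two_mul (T := cartanT F)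
      (r₀ := max r₀ 1) (s := s) (le_max_right _ _)
      ((monotoneOn_jensen hMconv).mono fun x hx =>
        lt_of_lt_of_le one_pos ((le_max_right r₀ 1).trans hx))
      (fun r hr => (hr₀ r ((le_max_left _ _).trans hr)).2.1)
      (fun r hr => (hr₀ r ((le_max_left _ _).trans hr)).1) hρ0 (by linarith) (by linarith)
    obtain ⟨C, hC⟩ := exists_abs_jensen_sub_le hconv hc hlin (by linarith : 0 < s)
    refine ⟨E, hE, ?_⟩
    refine IsBigO.trans_isLittleO (IsBigO.of_bound C ?_)
      ((one_add_div_rpow_isLittleO hc hlin' (by linarith) hs1).mono inf_le_left)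
    filter_upwards [mem_inf_of_left hC, mem_inf_of_left (eventually_ge_atTop (max r₀ 1)),
      mem_inf_of_right (mem_principal_self Eᶜ)] with r hCr hr hrE
    have hr0 : 0 < r := lt_of_lt_of_le one_pos ((le_max_right r₀ 1).trans hr)
    have hT0 : 0 ≤ cartanT F r := jensen_nonneg hMconv r
    rw [hcount r hr0, Real.norm_eq_abs, Real.norm_eq_abs,
      abs_of_nonneg (a := 1 + _) (by positivity)]
    exact hCr (hdouble r hr hrE)
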